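/- Let $\Gamma$ be a finite simplicial complex with vertex set $V$, i.e. a collection of subsets (faces) of the finite set $V$ that is closed under inclusion. Its dimension is one less than the maximum cardinality of a face, and $f_i(\Gamma)$ is the number of faces with $i+1$ vertices. For $W\subseteq V$, $\Gamma[W]$ is the complex on $W$ with faces $\{F\in\Gamma: F\subseteq W\}$; for $F\in\Gamma$, the link $\mathrm{lk}_\Gamma(F)$ is the complex on $V\setminus F$ with faces $\{G\setminus F: F\subseteq G\in\Gamma\}$. For a field $\mathbf{k}$, the $1$-girth of $\Gamma$ is $$\mathrm{gr}_1(\Gamma)=\min\{|W| : \tilde H_1(\mathrm{lk}_\Gamma(F)[W];\mathbf{k})\neq 0 \text{ for some } F\in\Gamma \text{ and } W\subseteq V\setminus F\},$$ where $\tilde H_1$ is reduced simplicial homology, $F=\emptyset$ is allowed, and $\mathrm{gr}_1(\Gamma)=\infty$ if no such $W$ exists. Theorem. For all integers $r\ge 2$ and $i\ge 0$ there is a constant $C_{r,i}$, depending only on $r$ and $i$, such that for every field $\mathbf{k}$ and every $(d-1)$-dimensional simplicial complex $\Gamma$ with $n$ vertices and $\mathrm{gr}_1(\Gamma)>2r$,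 $$f_i(\Gamma)\le C_{r,i}\, d^{\,i-1/r-1/r^2-\cdots-1/r^i}\, n^{\,1+1/r+1/r^2+\cdots+1/r^i}.$$ -/

import Mathlib

/-- A finite (abstract) simplicial complex: a finite vertex set together with a collection of
subsets of it, the faces, that is closed under inclusion. The empty set counts as a face (as soon
as there is any face), and a vertex need not be a face. -/
structure FinSimplicialComplex (α : Type*) where
  verts : Finset α
  faces : Finset (Finset α)
  subset_verts : ∀ F ∈ faces, F ⊆ verts
  down_closed : ∀ F ∈ faces, ∀ G, G ⊆ F → G ∈ faces

/-- The quotient `Z / (Z ∩ B)` of submodules of a common module. -/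
abbrev Subquotient {k M : Type*} [Ring k] [AddCommGroup M] [Module k M] (Z B : Submodule k M) :
    Type _ :=
  Z ⧸ B.submoduleOf Z

namespace FinSimplicialComplex

/-- The dimension: one less than the maximum cardinality of a face. -/
def dim {α : Type*} (Γ : FinSimplicialComplex α) : ℤ :=
  ((Γ.faces.sup Finset.card : ℕ) : ℤ) - 1

/-- The face number `f_i`: the number of faces with `i + 1` vertices. -/
def faceNumber {α : Type*} (Γ : FinSimplicialComplex α) (i : ℕ) : ℕ :=
  (Γ.faces.filter fun F => F.card = i + 1).card

/-- The induced subcomplex `Γ[W]`, for `W` a set of vertices of `Γ`. -/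
def induced {α : Type*} [DecidableEq α] (Γ : FinSimplicialComplex α) (W : Finset α) :
    FinSimplicialComplex α where
  verts := W
  faces := Γ.faces.filter fun F => F ⊆ W
  subset_verts F hF := (Finset.mem_filter.mp hF).2
  down_closed F hF G hG := by
    rw [Finset.mem_filter] at hF ⊢
    exact ⟨Γ.down_closed F hF.1 G hG, hG.trans hF.2⟩

/-- The link of `F`: its vertex set is `V \ F` and its faces are the sets `G \ F`
for the faces `G` of `Γ` that contain `F`. -/
def link {α : Type*} [DecidableEq α] (Γ : FinSimplicialComplex α) (F : Finset α) :
    FinSimplicialComplex α where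
  verts := Γ.verts \ F
  faces := (Γ.faces.filter fun G => F ⊆ G).image fun G => G \ F
  subset_verts H hH := by
    obtain ⟨G, hG, rfl⟩ := Finset.mem_image.mp hH
    exact Finset.sdiff_subset_sdiff (Γ.subset_verts G (Finset.mem_filter.mp hG).1) le_rfl
  down_closed H hH K hK := by
    obtain ⟨G, hG, rfl⟩ := Finset.mem_image.mp hH
    obtain ⟨hG, hFG⟩ := Finset.mem_filter.mp hG
    refine Finset.mem_image.mpr ⟨K ∪ F, Finset.mem_filter.mpr ⟨?_, Finset.subset_union_right⟩, ?_⟩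
    · exact Γ.down_closed G hG _ (Finset.union_subset (hK.trans Finset.sdiff_subset) hFG)
    · ext x
      have hx := @hK x
      simp only [Finset.mem_sdiff, Finset.mem_union] at hx ⊢
      tauto

/-- The simplicial boundary operator on formal `k`-linear combinations of finite subsets of a
linearly ordered set: `∂ {v₀ < ⋯ < v_m} = ∑ j, (-1)^j {v₀, …, v̂_j, …, v_m}`. In particular a
vertex is sent to the empty face (this is the augmentation) and `∅` is sent to `0`. -/
noncomputable def boundary (k : Type*) [Field k] (α : Type*) [LinearOrder α] :
    (Finset α →₀ k) →ₗ[k] (Finset α →₀ k) :=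
  Finsupp.linearCombination k fun F : Finset α =>
    ∑ v ∈ F, Finsupp.single (F.erase v) ((-1 : k) ^ (F.filter fun w => w < v).card)

/-- The reduced simplicial `m`-chains: combinations of the `m`-dimensional faces, `m ≥ -1`. -/
def chains (k : Type*) [Field k] {α : Type*} (Γ : FinSimplicialComplex α) (m : ℤ) :
    Submodule k (Finset α →₀ k) :=
  Finsupp.supported k k {F : Finset α | F ∈ Γ.faces ∧ (F.card : ℤ) = m + 1}

/-- The reduced simplicial `m`-cycles. -/
noncomputable def cycles (k : Type*) [Field k] {α : Type*} [LinearOrder α]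
    (Γ : FinSimplicialComplex α) (m : ℤ) : Submodule k (Finset α →₀ k) :=
  Γ.chains k m ⊓ LinearMap.ker (boundary k α)

/-- The reduced simplicial `m`-boundaries. -/
noncomputable def boundaries (k : Type*) [Field k] {α : Type*} [LinearOrder α]
    (Γ : FinSimplicialComplex α) (m : ℤ) : Submodule k (Finset α →₀ k) :=
  (Γ.chains k (m + 1)).map (boundary k α)

/-- The reduced simplicial homology of `Γ` in degree `m` with coefficients in `k`:
cycles modulo boundaries. -/
abbrev ReducedHomology (k : Type*) [Field k] {α : Type*} [LinearOrder α]
    (Γ : FinSimplicialComplex α) (m : ℤ) : Type _ :=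
  Subquotient (Γ.cycles k m) (Γ.boundaries k m)

/-- The `m`-girth of `Γ` over `k`: the least cardinality of a vertex set `W` of the link of a face
`F` (possibly empty) such that the subcomplex of that link induced on `W` has nonzero reduced
homology in degree `m`; it is `∞` if there is no such `W`. -/
noncomputable def girth (k : Type*) [Field k] {α : Type*} [LinearOrder α]
    (Γ : FinSimplicialComplex α) (m : ℤ) : ℕ∞ :=
  sInf {c : ℕ∞ | ∃ F ∈ Γ.faces, ∃ W ⊆ (Γ.link F).verts,
    Nontrivial (((Γ.link F).induced W).ReducedHomology k m) ∧ c = (W.card : ℕ∞)}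

end FinSimplicialComplex

/-!
A complex `Γ` whose `1`-girth exceeds `2 * r` is determined by its `1`-skeleton `G`: an induced
cycle of length `4, …, 2 * r` in `G`, or an empty triangle in a link, is an induced subcomplex on
few vertices with a nonzero `1`-cycle and no `2`-faces. Hence `G` has no such induced cycle
(`noHoles_oneSkeleton`), and `Γ` is flag (`mem_faces_of_clique`). The face numbers of `Γ`
thus count cliques of `G`, all of which have at most `d` vertices.

For graphs the key is a Moore-type bound (`pow_pairs_le`): `G` has at most of order
`d ^ (1 - 1 / r) * n ^ (1 + 1 / r)` edges. Suppose first that all degrees are of the same order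
`δ`, and that `δ` is much larger than `d`. Non-adjacent vertices have common neighbourhoods that are
cliques, so a dense subgraph would contain a clique that is too large (`card_le_or_mul_le`); thus
most neighbours of a vertex `y` have few common neighbours with `y`. Walks along such edges, without
triangles and backtracking, can therefore be extended in at least `δ / 2` ways at each step. Such walks of length
at most `r` are induced paths, and their penultimate vertices, for given ends, form a clique
(`IsLocallyInduced.eq_or_adj`). So each step multiplies the number of endpoints by at least
`δ / (2 * d)`, except that the first one multiplies it by `δ / 2`. After `r` steps this gives
`δ ^ r ≤ 2 ^ r * d ^ (r - 1) * n` (`pow_le_of_extension`). The general case reduces to this one by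
an induced form of Erdős–Simonovits regularisation (`exists_almost_regular`).

The bound applies to all induced subgraphs, so `G` is degenerate with parameter
`D = O(d ^ (1 - 1 / r) * n ^ (1 / r))`. Counting cliques by their first vertex in a degeneracy
ordering bounds the number of cliques with `i + 2` vertices by `n` times the number of cliques with
`i + 1` vertices in a graph of order `D`, and the theorem follows by induction on `i`
(`exists_card_cliquesIn_le`).
-/

/-! ### Holes and locally induced walks -/

namespace SimpleGraph

variable {α : Type*} {G : SimpleGraph α}

/-- The vertices `x 0, …, x (m - 1)` are distinct and span an induced cycle of length `m` in `G`,
in this cyclic order. -/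
def IsHole (G : SimpleGraph α) (m : ℕ) (x : ℕ → α) : Prop :=
  ∀ a b, a < b → b < m →
    x a ≠ x b ∧ (G.Adj (x a) (x b) ↔ b = a + 1 ∨ (a = 0 ∧ b + 1 = m))

/-- `G` has no induced cycle whose length lies between `4` and `N`. -/
def NoHoles (G : SimpleGraph α) (N : ℕ) : Prop :=
  ∀ m x, 4 ≤ m → m ≤ N → ¬ G.IsHole m x

/-- `w 0, …, w j` is a walk in which any three consecutive vertices form an induced path. -/
def IsLocallyInduced (G : SimpleGraph α) (j : ℕ) (w : ℕ → α) : Prop :=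
  (∀ i < j, G.Adj (w i) (w (i + 1))) ∧
    ∀ i, i + 2 ≤ j → w i ≠ w (i + 2) ∧ ¬ G.Adj (w i) (w (i + 2))

/-- Without short holes, a locally induced walk is an induced path: the closest pair of vertices
violating this would close up to a hole. -/
lemma IsLocallyInduced.isInduced {N j : ℕ} {w : ℕ → α} (hG : G.NoHoles N)
    (hw : G.IsLocallyInduced j w) (hj : j + 1 ≤ N) (a b : ℕ) (hab : a < b) (hb : b ≤ j) :
    w a ≠ w b ∧ (G.Adj (w a) (w b) ↔ b = a + 1) := by
  obtain ⟨l, rfl⟩ : ∃ l, b = a + l := ⟨b - a, by omega⟩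
  induction l using Nat.strong_induction_on generalizing a with
  | _ l ih =>
  have ih' : ∀ p q, a ≤ p → p < q → q ≤ a + l → q - p < l →
      w p ≠ w q ∧ (G.Adj (w p) (w q) ↔ q = p + 1) := by
    intro p q hp hpq hq hl
    have := ih (q - p) hl p (by omega) (by omega)
    rwa [show p + (q - p) = q by omega] at this
  rcases (by omega : l = 1 ∨ l = 2 ∨ 3 ≤ l) with rfl | rfl | hl
  · have := hw.1 a (by omega)
    exact ⟨this.ne, by simpa using this⟩
  · have := hw.2 a hb
    exact ⟨this.1, by simpa using this.2⟩
  · have hne : w a ≠ w (a + l) := by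
      intro h
      have h1 := hw.1 (a + l - 1) (by omega)
      rw [show a + l - 1 + 1 = a + l by omega, ← h] at h1
      have h2 := (ih' a (a + l - 1) le_rfl (by omega) (by omega) (by omega)).2.1 h1.symm
      omega
    refine ⟨hne, ⟨fun h => ?_, fun h => by omega⟩⟩
    refine (hG (l + 1) (fun i => w (a + i)) (by omega) (by omega) ?_).elim
    intro p q hpq hq
    by_cases hpq' : p = 0 ∧ q = l
    · obtain ⟨rfl, rfl⟩ := hpq'
      exact ⟨hne, by simpa using h⟩
    · have := ih' (a + p) (a + q) (by omega) (by omega) (by omega) (by omega)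
      refine ⟨this.1, this.2.trans ?_⟩
      omega

/-- Two locally induced walks of length at most `r` with the same ends have equal or adjacent
penultimate vertices: otherwise their union contains an induced cycle of even length at most
`2 * r`. -/
lemma IsLocallyInduced.eq_or_adj {r j : ℕ} {w w' : ℕ → α} (hG : G.NoHoles (2 * r))
    (hw : G.IsLocallyInduced j w) (hw' : G.IsLocallyInduced j w') (hj : j ≤ r)
    (h0 : w 0 = w' 0) (hend : w j = w' j) :
    w (j - 1) = w' (j - 1) ∨ G.Adj (w (j - 1)) (w' (j - 1)) := by
  by_cases hj1 : j ≤ 1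
  · left
    rw [show j - 1 = 0 by omega, h0]
  by_contra! hcon
  -- the path from `w 1` through the common end to `w' 1`
  set u : ℕ → α := fun i => if i < j then w (i + 1) else w' (2 * j - 1 - i) with hu
  have u1 : ∀ i, i < j → u i = w (i + 1) := fun i hi => by simp [hu, hi]
  have u2 : ∀ i, j ≤ i → u i = w' (2 * j - 1 - i) := fun i hi => by simp [hu, hi]
  have u3 : ∀ i, j ≤ i + 1 → u i = w' (2 * j - 1 - i) := by
    intro i hi
    rcases Nat.lt_or_ge i j with h | h
    · rw [u1 i h, show i + 1 = j by omega, show 2 * j - 1 - i = j by omega, hend]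
    · exact u2 i h
  have hloc : G.IsLocallyInduced (2 * j - 2) u := by
    constructor
    · intro i hi
      rcases Nat.lt_or_ge (i + 1) j with h | h
      · rw [u1 _ h, u1 i (by omega)]
        exact hw.1 _ (by omega)
      · rw [u3 i h, u3 (i + 1) (by omega)]
        have := hw'.1 (2 * j - 1 - (i + 1)) (by omega)
        rw [show 2 * j - 1 - (i + 1) + 1 = 2 * j - 1 - i by omega] at this
        exact this.symm
    · intro i hi
      rcases Nat.lt_or_ge (i + 2) j with h | h
      · rw [u1 _ h, u1 i (by omega)]
        exact hw.2 (i + 1) (by omega)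
      · rcases Nat.lt_or_ge (i + 1) j with h' | h'
        · rw [u1 i (by omega), u2 (i + 2) h, show i + 1 = j - 1 by omega,
            show 2 * j - 1 - (i + 2) = j - 1 by omega]
          exact hcon
        · rw [u3 i h', u3 (i + 2) (by omega)]
          have := hw'.2 (2 * j - 1 - (i + 2)) (by omega)
          rw [show 2 * j - 1 - (i + 2) + 2 = 2 * j - 1 - i by omega] at this
          exact ⟨this.1.symm, fun h => this.2 h.symm⟩
  have hind := hloc.isInduced hG (by omega)
  have hindw := hw.isInduced hG (by omega)
  have hindw' := hw'.isInduced hG (by omega)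
  refine hG (2 * j) (fun i => if i = 0 then w 0 else u (i - 1)) (by omega) (by omega) ?_
  intro a b hab hb
  have hb0 : b ≠ 0 := by omega
  simp only [hb0, if_false]
  by_cases ha : a = 0
  · subst ha
    simp only [if_true]
    rcases Nat.lt_or_ge (b - 1) j with h | h
    · rw [u1 _ h]
      have := hindw 0 (b - 1 + 1) (by omega) (by omega)
      refine ⟨this.1, this.2.trans ?_⟩
      omega
    · rw [u2 _ h, h0]
      have := hindw' 0 (2 * j - 1 - (b - 1)) (by omega) (by omega)
      refine ⟨this.1, this.2.trans ?_⟩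
      simp only [true_and]
      omega
  · simp only [ha, if_false]
    have := hind (a - 1) (b - 1) (by omega) (by omega)
    refine ⟨this.1, this.2.trans ?_⟩
    simp only [false_and, or_false]
    omega

/-- Common neighbours of two distinct non-adjacent vertices are adjacent to each other. -/
lemma NoHoles.eq_or_adj_of_common {r : ℕ} (hG : G.NoHoles (2 * r)) (hr : 2 ≤ r) {x y p q : α}
    (hne : x ≠ y) (hxy : ¬ G.Adj x y) (hxp : G.Adj x p) (hpy : G.Adj p y) (hxq : G.Adj x q)
    (hqy : G.Adj q y) : p = q ∨ G.Adj p q := by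
  have key : ∀ z, G.Adj x z → G.Adj z y →
      G.IsLocallyInduced 2 (fun i => if i = 0 then x else if i = 1 then z else y) := by
    intro z h1 h2
    constructor
    · intro i hi
      interval_cases i <;> simpa
    · intro i hi
      obtain rfl : i = 0 := by omega
      simpa using ⟨hne, hxy⟩
  simpa using (key p hxp hpy).eq_or_adj hG (key q hxq hqy) hr (by simp) (by simp)

lemma CliqueFree.card_le {d : ℕ} (hG : G.CliqueFree (d + 1)) {s : Finset α}
    (hs : ∀ p ∈ s, ∀ q ∈ s, p ≠ q → G.Adj p q) : s.card ≤ d := by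
  by_contra! h
  obtain ⟨t, hts, ht⟩ := Finset.exists_subset_card_eq (Nat.succ_le_of_lt h)
  exact hG t ⟨fun p hp q hq hpq => hs p (hts hp) q (hts hq) hpq, ht⟩

end SimpleGraph

/-! ### Almost regular graphs without short holes -/

namespace SimpleGraph

variable {α : Type*} {G : SimpleGraph α} [DecidableEq α] [DecidableRel G.Adj]

lemma sum_card_le_card_biUnion_add {ι : Type*} [DecidableEq ι] {I : Finset ι} {A : ι → Finset α}
    {d : ℕ} (hA : ∀ i ∈ I, ∀ j ∈ I, i ≠ j → (A i ∩ A j).card ≤ d) :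
    ∑ i ∈ I, (A i).card ≤ (I.biUnion A).card + I.card ^ 2 * d := by
  induction I using Finset.induction_on with
  | empty => simp
  | insert i I hi ih =>
    rw [Finset.sum_insert hi, Finset.biUnion_insert, Finset.card_insert_of_notMem hi]
    have h1 := ih fun a ha b hb => hA a (Finset.mem_insert_of_mem ha) b (Finset.mem_insert_of_mem hb)
    have h2 := Finset.card_union_add_card_inter (A i) (I.biUnion A)
    have h3 : (A i ∩ I.biUnion A).card ≤ I.card * d := by
      rw [Finset.inter_biUnion]
      refine Finset.card_biUnion_le_card_mul _ _ _ fun j hj => ?_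
      exact hA i (Finset.mem_insert_self _ _) j (Finset.mem_insert_of_mem hj)
        (by rintro rfl; exact hi hj)
    nlinarith

variable (G) in
/-- The neighbours of `v` inside the finite set `S`. -/
def nbrs (S : Finset α) (v : α) : Finset α := S.filter (G.Adj v)

omit [DecidableEq α] in
@[simp] lemma mem_nbrs {S : Finset α} {v x : α} : x ∈ G.nbrs S v ↔ x ∈ S ∧ G.Adj v x := by
  simp [nbrs]

/-- If no set of `m` vertices of `Q` is independent, then `Q` is covered by the private
neighbourhoods of the members of a maximum independent set, and by their pairwise common
neighbourhoods. All of these are cliques. -/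
lemma NoHoles.exists_independent_or_card_le {r d m : ℕ} (hG : G.NoHoles (2 * r)) (hr : 2 ≤ r)
    (hd : G.CliqueFree (d + 1)) (Q : Finset α) :
    (∃ I ⊆ Q, I.card = m ∧ ∀ p ∈ I, ∀ q ∈ I, ¬ G.Adj p q) ∨ Q.card ≤ m ^ 2 * d := by
  obtain ⟨I, hI, hmax⟩ := Finset.exists_max_image
    (Q.powerset.filter fun I => ∀ p ∈ I, ∀ q ∈ I, ¬ G.Adj p q) Finset.card
    ⟨∅, by simp⟩
  simp only [Finset.mem_filter, Finset.mem_powerset] at hI hmax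
  obtain ⟨hIQ, hI⟩ := hI
  rcases le_or_gt m I.card with h | h
  · left
    obtain ⟨J, hJ, hJm⟩ := Finset.exists_subset_card_eq h
    exact ⟨J, hJ.trans hIQ, hJm, fun p hp q hq => hI p (hJ hp) q (hJ hq)⟩
  right
  -- common closed neighbourhoods for `i ≠ j`, private closed neighbourhoods for `i = j`
  set T : α × α → Finset α := fun ij => Q.filter fun q =>
    (q = ij.1 ∨ G.Adj ij.1 q) ∧ (q = ij.2 ∨ G.Adj ij.2 q) ∧
      (ij.1 = ij.2 → ∀ l ∈ I, (q = l ∨ G.Adj l q) → l = ij.1) with hT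
  have hcover : Q ⊆ (I ×ˢ I).biUnion T := by
    intro q hq
    have hex : ∃ i ∈ I, q = i ∨ G.Adj i q := by
      by_contra! hcon
      have hqI : q ∉ I := fun h => (hcon q h).1 rfl
      have := hmax (insert q I) ⟨Finset.insert_subset hq hIQ, by
        intro a ha b hb
        rcases Finset.mem_insert.1 ha with rfl | ha' <;>
          rcases Finset.mem_insert.1 hb with rfl | hb'
        · exact G.loopless.irrefl _
        · exact fun h => (hcon b hb').2 h.symm
        · exact (hcon a ha').2
        · exact hI a ha' b hb'⟩
      rw [Finset.card_insert_of_notMem hqI] at this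
      omega
    obtain ⟨i, hi, hiq⟩ := hex
    by_cases hu : ∀ l ∈ I, (q = l ∨ G.Adj l q) → l = i
    · exact Finset.mem_biUnion.2 ⟨(i, i), by simp [hi], by
        simp only [hT, Finset.mem_filter]; exact ⟨hq, hiq, hiq, fun _ => hu⟩⟩
    · push Not at hu
      obtain ⟨l, hl, hlq, hli⟩ := hu
      exact Finset.mem_biUnion.2 ⟨(i, l), by simp [hi, hl], by
        simp only [hT, Finset.mem_filter]; exact ⟨hq, hiq, hlq, fun h => (hli h.symm).elim⟩⟩
  have hclique : ∀ ij ∈ I ×ˢ I, (T ij).card ≤ d := by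
    rintro ⟨i, j⟩ hij
    obtain ⟨hi, hj⟩ := Finset.mem_product.1 hij
    simp only at hi hj
    refine hd.card_le fun p hp q hq hpq => ?_
    simp only [hT, Finset.mem_filter] at hp hq
    obtain ⟨hpQ, hp1, hp2, hp3⟩ := hp
    obtain ⟨hqQ, hq1, hq2, hq3⟩ := hq
    by_cases hij : i = j
    · -- exchanging `i` for `p` and `q` would enlarge the independent set
      subst hij
      by_contra hadj
      have hpi : G.Adj i p := by
        rcases hp1 with rfl | h
        · rcases hq1 with rfl | h
          · exact (hpq rfl).elim
          · exact (hadj h).elim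
        · exact h
      have hqi : G.Adj i q := by
        rcases hq1 with rfl | h
        · exact (hadj hpi.symm).elim
        · exact h
      have hpI : p ∉ I := fun h => hI i hi p h hpi
      have hqI : q ∉ I := fun h => hI i hi q h hqi
      have hother : ∀ z, (∀ l ∈ I, (z = l ∨ G.Adj l z) → l = i) → ∀ l ∈ I.erase i, ¬ G.Adj l z :=
        fun z hz l hl h => (Finset.mem_erase.1 hl).1 (hz l (Finset.mem_erase.1 hl).2 (Or.inr h))
      have := hmax (insert p (insert q (I.erase i))) ⟨by
          refine Finset.insert_subset hpQ (Finset.insert_subset hqQ ?_)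
          exact (Finset.erase_subset _ _).trans hIQ, by
        have e : ∀ a ∈ I.erase i, ∀ b ∈ I.erase i, ¬ G.Adj a b := fun a ha b hb =>
          hI a (Finset.mem_of_mem_erase ha) b (Finset.mem_of_mem_erase hb)
        have ep := hother p (hp3 rfl)
        have eq := hother q (hq3 rfl)
        intro a ha b hb
        simp only [Finset.mem_insert] at ha hb
        rcases ha with rfl | rfl | ha <;> rcases hb with rfl | rfl | hb
        · exact G.loopless.irrefl _
        · exact hadj
        · exact fun h => ep b hb h.symm
        · exact fun h => hadj h.symm
        · exact G.loopless.irrefl _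
        · exact fun h => eq b hb h.symm
        · exact ep a ha
        · exact eq a ha
        · exact e a ha b hb⟩
      have hpos : 0 < I.card := Finset.card_pos.2 ⟨i, hi⟩
      rw [Finset.card_insert_of_notMem (by simp [hpq, hpI]),
        Finset.card_insert_of_notMem (by simp [hqI]), Finset.card_erase_of_mem hi] at this
      omega
    · have hadj := hI i hi j hj
      have key : ∀ z, (z = i ∨ G.Adj i z) → (z = j ∨ G.Adj j z) → G.Adj i z ∧ G.Adj z j := by
        rintro z (rfl | h) (rfl | h')
        · exact (hij rfl).elim
        · exact (hadj h'.symm).elim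
        · exact (hadj h).elim
        · exact ⟨h, h'.symm⟩
      exact (hG.eq_or_adj_of_common hr hij hadj (key p hp1 hp2).1 (key p hp1 hp2).2
        (key q hq1 hq2).1 (key q hq1 hq2).2).resolve_left hpq
  calc Q.card ≤ _ := Finset.card_le_card hcover
    _ ≤ (I ×ˢ I).card * d := Finset.card_biUnion_le_card_mul _ _ _ hclique
    _ = I.card ^ 2 * d := by rw [Finset.card_product, sq]
    _ ≤ m ^ 2 * d := by gcongr

/-- If many vertices have large degree into a set `P`, then `P` is large: an independent set of
`m` of these vertices has neighbourhoods in `P` that overlap pairwise in cliques only. -/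
lemma NoHoles.card_le_or_mul_le {r d m D : ℕ} (hG : G.NoHoles (2 * r)) (hr : 2 ≤ r)
    (hd : G.CliqueFree (d + 1)) {P Q : Finset α} (hQ : ∀ x ∈ Q, D ≤ (G.nbrs P x).card) :
    Q.card ≤ m ^ 2 * d ∨ m * D ≤ P.card + m ^ 2 * d := by
  rcases hG.exists_independent_or_card_le (m := m) hr hd Q with ⟨I, hIQ, rfl, hI⟩ | h
  · right
    have h1 : ∑ x ∈ I, (G.nbrs P x).card ≤ (I.biUnion (G.nbrs P)).card + I.card ^ 2 * d := by
      refine sum_card_le_card_biUnion_add fun i hi j hj hij => ?_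
      refine hd.card_le fun p hp q hq hpq => ?_
      simp only [Finset.mem_inter, mem_nbrs] at hp hq
      exact (hG.eq_or_adj_of_common hr hij (hI i hi j hj) hp.1.2 hp.2.2.symm hq.1.2
        hq.2.2.symm).resolve_left hpq
    have h2 : (I.biUnion (G.nbrs P)).card ≤ P.card :=
      Finset.card_le_card (Finset.biUnion_subset.2 fun x _ => Finset.filter_subset _ _)
    have h3 : I.card * D ≤ ∑ x ∈ I, (G.nbrs P x).card := by
      rw [← smul_eq_mul]
      exact Finset.card_nsmul_le_sum _ _ _ fun x hx => hQ x (hIQ hx)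
    omega
  · exact Or.inl h

/-- The Moore-type growth argument. Locally induced walks with good edges are grown from one vertex:
each endpoint extends to at least `δ / 2` new endpoints, and each new endpoint is reached from at
most `d` penultimate vertices, since these form a clique. In the application, an edge is good if its
ends have few common neighbours. -/
lemma NoHoles.pow_le_of_extension {r d δ : ℕ} (hG : G.NoHoles (2 * r)) (hd : G.CliqueFree (d + 1))
    {S : Finset α} {x₀ : α} (hx₀ : x₀ ∈ S) (good : α → α → Prop)
    [DecidableRel good]
    (hext₁ : ∀ y ∈ S, δ ≤ 2 * ((G.nbrs S y).filter fun z => good y z).card)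
    (hext : ∀ x ∈ S, ∀ y ∈ S, G.Adj x y → good x y →
      δ ≤ 2 * ((G.nbrs S y).filter fun z => good y z ∧ x ≠ z ∧ ¬ G.Adj x z).card)
    (j : ℕ) (hj : j + 1 ≤ r) : δ ^ (j + 1) ≤ 2 ^ (j + 1) * d ^ j * S.card := by
  classical
  -- `R j x y`: some walk of length `j` ends with the edge from `x` to `y`; `E j`: the endpoints
  set R : ℕ → α → α → Prop := fun j x y => ∃ w, G.IsLocallyInduced j w ∧ w 0 = x₀ ∧
    w (j - 1) = x ∧ w j = y ∧ x ∈ S ∧ y ∈ S ∧ G.Adj x y ∧ good x y with hR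
  set E : ℕ → Finset α := fun j => S.filter fun y => ∃ x, R j x y with hE
  suffices h : ∀ j, j + 1 ≤ r → δ ^ (j + 1) ≤ 2 ^ (j + 1) * d ^ j * (E (j + 1)).card from
    (h j hj).trans (Nat.mul_le_mul_left _ (Finset.card_le_card (Finset.filter_subset _ _)))
  intro j
  induction j with
  | zero =>
    intro _
    have : (G.nbrs S x₀).filter (fun z => good x₀ z) ⊆ E 1 := by
      intro z hz
      simp only [Finset.mem_filter, mem_nbrs] at hz
      refine Finset.mem_filter.2 ⟨hz.1.1, x₀, fun i => if i = 0 then x₀ else z, ?_, by simp, by simp,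
        by simp, hx₀, hz.1.1, hz.1.2, hz.2⟩
      refine ⟨fun i hi => ?_, fun i hi => by omega⟩
      obtain rfl : i = 0 := by omega
      simpa using hz.1.2
    have h1 := hext₁ x₀ hx₀
    have h2 := Finset.card_le_card this
    simp only [zero_add, pow_one, pow_zero, mul_one]
    omega
  | succ j ih =>
    intro hj
    have h1 := ih (by omega)
    have h2 : (E (j + 1)).card * ((δ + 1) / 2) ≤ (E (j + 2)).card * d := by
      refine Finset.card_mul_le_card_mul (R (j + 2)) (fun y hy => ?_) (fun z hz => ?_)
      · obtain ⟨hyS, x, w, hw, hw0, hwx, hwy, hxS, -, hxy, hgood⟩ := Finset.mem_filter.1 hy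
        have h3 := hext x hxS y hyS hxy hgood
        have h4 : (G.nbrs S y).filter (fun z => good y z ∧ x ≠ z ∧ ¬ G.Adj x z) ⊆
            (E (j + 2)).bipartiteAbove (R (j + 2)) y := by
          intro z hz
          simp only [Finset.mem_filter, mem_nbrs] at hz
          obtain ⟨⟨hzS, hyz⟩, hg, hne, hna⟩ := hz
          have hRz : R (j + 2) y z := by
            refine ⟨fun i => if i ≤ j + 1 then w i else z, ⟨fun i hi => ?_, fun i hi => ?_⟩,
              by simpa using hw0, by simpa using hwy, by simp, hyS, hzS, hyz, hg⟩
            · rcases Nat.lt_or_ge i (j + 1) with h | h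
              · simpa [h.le, Nat.succ_le_of_lt h] using hw.1 i h
              · obtain rfl : i = j + 1 := by omega
                simpa [hwy] using hyz
            · rcases Nat.lt_or_ge i j with h | h
              · simpa [show i ≤ j + 1 by omega, show i + 2 ≤ j + 1 by omega] using
                  hw.2 i (by omega)
              · obtain rfl : i = j := by omega
                simp only [Nat.add_sub_cancel] at hwx
                simpa [hwx] using ⟨hne, hna⟩
          exact Finset.mem_filter.2 ⟨Finset.mem_filter.2 ⟨hzS, y, hRz⟩, hRz⟩
        have h5 := Finset.card_le_card h4
        omega
      · refine hd.card_le fun p hp q hq hpq => ?_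
        obtain ⟨-, w, hw, hw0, hwp, hwz, -⟩ := Finset.mem_filter.1 hp
        obtain ⟨-, w', hw', hw0', hwq, hwz', -⟩ := Finset.mem_filter.1 hq
        have := hw.eq_or_adj hG hw' (by omega) (hw0.trans hw0'.symm) (hwz.trans hwz'.symm)
        rw [hwp, hwq] at this
        exact this.resolve_left hpq
    have h3 : δ ≤ 2 * ((δ + 1) / 2) := by omega
    calc δ ^ (j + 1 + 1) = δ ^ (j + 1) * δ := pow_succ _ _
      _ ≤ (2 ^ (j + 1) * d ^ j * (E (j + 1)).card) * (2 * ((δ + 1) / 2)) := Nat.mul_le_mul h1 h3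
      _ = 2 ^ (j + 1 + 1) * d ^ j * ((E (j + 1)).card * ((δ + 1) / 2)) := by ring
      _ ≤ 2 ^ (j + 1 + 1) * d ^ j * ((E (j + 2)).card * d) := by gcongr
      _ = _ := by ring

/-- The Moore-type bound for graphs all of whose degrees lie between `δ` and `K * δ`. If `δ` is not
already of order `d`, then by `card_le_or_mul_le` every vertex `y` has only few neighbours that have
many common neighbours with `y`, and `pow_le_of_extension` applies. -/
lemma NoHoles.pow_le_of_almost_regular {r d δ K : ℕ} (hG : G.NoHoles (2 * r)) (hr : 2 ≤ r)
    (hd : G.CliqueFree (d + 1)) (hK : 1 ≤ K) {S : Finset α} (hS : S.Nonempty)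
    (h1 : ∀ v ∈ S, δ ≤ (G.nbrs S v).card) (h2 : ∀ v ∈ S, (G.nbrs S v).card ≤ K * δ) :
    δ ^ r ≤ (512 * K ^ 2) ^ r * (S.card * d ^ (r - 1)) := by
  obtain ⟨x₀, hx₀⟩ := hS
  obtain ⟨j, rfl⟩ : ∃ j, r = j + 1 := ⟨r - 1, by omega⟩
  simp only [Nat.add_sub_cancel]
  have hd1 : 1 ≤ d := by
    simpa using hd.card_le (s := {x₀}) (by simp)
  have hδS : δ ≤ S.card := (h1 x₀ hx₀).trans (Finset.card_le_card (Finset.filter_subset _ _))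
  have hC : 1 ≤ 512 * K ^ 2 := by nlinarith
  rcases Nat.lt_or_ge (512 * K ^ 2 * d) δ with hlt | hle
  · set codeg : α → α → ℕ := fun x y => (G.nbrs (G.nbrs S y) x).card with hcodeg
    have hsymm : ∀ x y, codeg x y = codeg y x := by
      intro x y
      simp only [hcodeg]
      congr 1
      ext z
      simp only [mem_nbrs]
      tauto
    have hbad : ∀ y ∈ S, ((G.nbrs S y).filter fun z => ¬ 4 * codeg y z < δ).card
        ≤ 64 * K ^ 2 * d := by
      intro y hy
      -- `m = 8 * K` neighbours with `δ / 4` common neighbours each would fill `2 * K * δ` vertices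
      have := hG.card_le_or_mul_le (m := 8 * K) (D := (δ + 3) / 4) hr hd (P := G.nbrs S y)
        (Q := (G.nbrs S y).filter fun z => ¬ 4 * codeg y z < δ) (by
          intro z hz
          have hz := (Finset.mem_filter.1 hz).2
          rw [hsymm] at hz
          simp only [hcodeg] at hz
          omega)
      rcases this with h | h
      · calc _ ≤ _ := h
          _ = _ := by ring
      · exfalso
        have h3 := h2 y hy
        have h4 : δ ≤ 4 * ((δ + 3) / 4) := by omega
        have h5 : 2 * K * δ ≤ 8 * K * ((δ + 3) / 4) := by nlinarith
        have h6 : K * δ ≤ 64 * K ^ 2 * d := by nlinarith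
        have h7 : K * (512 * K ^ 2 * d) < K * δ := by
          apply Nat.mul_lt_mul_of_pos_left hlt (by omega)
        have h8 : 64 * K ^ 2 * d ≤ K * (512 * K ^ 2 * d) := by
          have : K ^ 2 * d ≤ K * (K ^ 2 * d) := Nat.le_mul_of_pos_left _ (by omega)
          nlinarith
        omega
    have hδ8 : 512 ≤ δ := by nlinarith [Nat.mul_le_mul (Nat.pow_le_pow_left hK 2) hd1]
    have hsplit : ∀ y, (G.nbrs S y).card = ((G.nbrs S y).filter fun z => 4 * codeg y z < δ).card +
        ((G.nbrs S y).filter fun z => ¬ 4 * codeg y z < δ).card := fun y =>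
      (Finset.card_filter_add_card_filter_not _).symm
    have key := hG.pow_le_of_extension (δ := δ) hd hx₀ (fun x y => 4 * codeg x y < δ) (by
        intro y hy
        have e1 := hbad y hy
        have e2 := h1 y hy
        have e3 := hsplit y
        have e4 : 512 * K ^ 2 * d = 8 * (64 * K ^ 2 * d) := by ring
        change δ ≤ 2 * ((G.nbrs S y).filter fun z => 4 * codeg y z < δ).card
        omega) (by
        intro x hx y hy hxy hgood
        have e1 := hbad y hy
        have e2 := h1 y hy
        have e3 := hsplit y
        have e4 : 512 * K ^ 2 * d = 8 * (64 * K ^ 2 * d) := by ring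
        have e5 : (G.nbrs S y).filter (fun z => 4 * codeg y z < δ) ⊆
            insert x ((G.nbrs (G.nbrs S y) x) ∪
              (G.nbrs S y).filter fun z => 4 * codeg y z < δ ∧ x ≠ z ∧ ¬ G.Adj x z) := by
          intro z hz
          simp only [Finset.mem_insert, Finset.mem_union, Finset.mem_filter, mem_nbrs] at hz ⊢
          tauto
        have e6 := (Finset.card_le_card e5).trans (Finset.card_insert_le _ _)
        have e7 := Finset.card_union_le (G.nbrs (G.nbrs S y) x)
          ((G.nbrs S y).filter fun z => 4 * codeg y z < δ ∧ x ≠ z ∧ ¬ G.Adj x z)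
        have e8 : 4 * (G.nbrs (G.nbrs S y) x).card < δ := hgood
        change δ ≤ 2 * ((G.nbrs S y).filter
          fun z => 4 * codeg y z < δ ∧ x ≠ z ∧ ¬ G.Adj x z).card
        omega) j le_rfl
    calc δ ^ (j + 1) ≤ _ := key
      _ = 2 ^ (j + 1) * (S.card * d ^ j) := by ring
      _ ≤ _ := by gcongr; nlinarith
  · calc δ ^ (j + 1) = δ ^ j * δ := pow_succ _ _
      _ ≤ (512 * K ^ 2 * d) ^ j * S.card := by gcongr
      _ = (512 * K ^ 2) ^ j * (S.card * d ^ j) := by rw [mul_pow]; ring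
      _ ≤ _ := by gcongr; omega

end SimpleGraph

/-! ### Passing to an almost regular induced subgraph -/

namespace SimpleGraph

variable {α : Type*} {G : SimpleGraph α} [DecidableEq α] [DecidableRel G.Adj]

/-- Some `k` elements of `S` have at least average total weight. -/
lemma exists_subset_card_mul_sum_le (f : α → ℕ) (S : Finset α) {k : ℕ} (hk : k ≤ S.card) :
    ∃ T ⊆ S, T.card = k ∧ k * ∑ x ∈ S, f x ≤ S.card * ∑ x ∈ T, f x := by
  induction S using Finset.strongInduction with
  | H S ih =>
  rcases hk.eq_or_lt with rfl | hlt
  · exact ⟨S, subset_rfl, rfl, le_rfl⟩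
  have hne : S.Nonempty := Finset.card_pos.1 (by omega)
  obtain ⟨x, hx, hmin⟩ := Finset.exists_min_image S f hne
  have hcard := Finset.card_erase_add_one hx
  obtain ⟨T, hT, hTk, hsum⟩ := ih (S.erase x) (Finset.erase_ssubset hx) (by omega)
  refine ⟨T, hT.trans (Finset.erase_subset _ _), hTk, ?_⟩
  have h1 : k * f x ≤ ∑ y ∈ T, f y := by
    rw [← hTk, ← smul_eq_mul]
    exact Finset.card_nsmul_le_sum _ _ _ fun y hy => hmin y (Finset.mem_of_mem_erase (hT hy))
  rw [← Finset.add_sum_erase _ _ hx, ← hcard]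
  nlinarith

variable (G) in
/-- The number of adjacent pairs in `A × B`. In particular `G.pairs A A` is twice the number of
edges inside `A`. -/
def pairs (A B : Finset α) : ℕ := ∑ u ∈ A, (G.nbrs B u).card

omit [DecidableEq α] in
lemma pairs_comm (A B : Finset α) : G.pairs A B = G.pairs B A := by
  have := Finset.sum_card_bipartiteAbove_eq_sum_card_bipartiteBelow G.Adj (s := A) (t := B)
  simpa only [pairs, nbrs, Finset.bipartiteAbove, Finset.bipartiteBelow, G.adj_comm] using this

omit [DecidableEq α] in
lemma nbrs_mono {A B : Finset α} (h : A ⊆ B) (v : α) : G.nbrs A v ⊆ G.nbrs B v :=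
  Finset.filter_subset_filter _ h

lemma pairs_union_left {A B : Finset α} (h : Disjoint A B) (C : Finset α) :
    G.pairs (A ∪ B) C = G.pairs A C + G.pairs B C :=
  Finset.sum_union h

lemma pairs_union_right {A B : Finset α} (h : Disjoint A B) (C : Finset α) :
    G.pairs C (A ∪ B) = G.pairs C A + G.pairs C B := by
  rw [pairs_comm, pairs_union_left h, pairs_comm A, pairs_comm B]

lemma pairs_eq_erase_add {S : Finset α} {v : α} (hv : v ∈ S) :
    G.pairs S S = G.pairs (S.erase v) (S.erase v) + 2 * (G.nbrs S v).card := by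
  have hdis : Disjoint {v} (S.erase v) := by simp
  have hS : {v} ∪ S.erase v = S := by
    rw [← Finset.insert_eq, Finset.insert_erase hv]
  have h0 : G.pairs {v} {v} = 0 := by
    simp [pairs, nbrs, Finset.filter_singleton]
  have h1 : G.pairs {v} S = (G.nbrs S v).card := by simp [pairs]
  have h2 : G.pairs {v} S = G.pairs {v} {v} + G.pairs {v} (S.erase v) := by
    rw [← pairs_union_right hdis, hS]
  have h3 : G.pairs S S = G.pairs {v} S + G.pairs (S.erase v) S := by
    rw [← pairs_union_left hdis, hS]
  have h4 : G.pairs (S.erase v) S = G.pairs (S.erase v) {v} +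
      G.pairs (S.erase v) (S.erase v) := by
    rw [← pairs_union_right hdis, hS]
  have h5 := pairs_comm (G := G) (S.erase v) {v}
  omega

/-- If `U` maximises `(G.pairs U U) ^ r / U.card ^ (r + 1)` among its subsets, then the vertices
whose degree is much larger than the average carry at most a quarter of the degree sum: adding to
this small set `A` the equally many vertices with most neighbours in `A` would otherwise give a
denser set. -/
lemma four_mul_pairs_le {r : ℕ} (hr : 1 ≤ r) {U : Finset α} (hE : 0 < G.pairs U U)
    (hmax : ∀ T ⊆ U, (G.pairs T T) ^ r * U.card ^ (r + 1) ≤ (G.pairs U U) ^ r * T.card ^ (r + 1))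
    {A : Finset α} (hAU : A ⊆ U)
    (hA : ∀ v ∈ A, 2 ^ (3 * r + 1) * G.pairs U U ≤ U.card * (G.nbrs U v).card) :
    4 * G.pairs A U ≤ G.pairs U U := by
  set E := G.pairs U U with hEdef
  set N := U.card with hN
  set X := G.pairs A U with hX
  set s := A.card with hs
  set K := 2 ^ (3 * r + 1) with hK
  have hdis : Disjoint A (U \ A) := Finset.disjoint_sdiff
  have hAUn : A ∪ (U \ A) = U := Finset.union_sdiff_of_subset hAU
  have hEX : E = X + G.pairs (U \ A) U := by
    rw [hX, ← pairs_union_left hdis, hAUn]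
  have hXA : X = G.pairs A A + G.pairs (U \ A) A := by
    rw [pairs_comm (U \ A) A, ← pairs_union_right hdis, hAUn]
  rcases Nat.eq_zero_or_pos s with hs0 | hspos
  · have : A = ∅ := Finset.card_eq_zero.1 hs0
    simp [hX, this, pairs]
  have h1 : s * (K * E) ≤ N * X := by
    rw [hX, pairs, Finset.mul_sum, ← smul_eq_mul]
    exact Finset.card_nsmul_le_sum _ _ _ hA
  have hsK : s * K ≤ N := by
    have : (s * K) * E ≤ N * E := by
      calc (s * K) * E = s * (K * E) := by ring
        _ ≤ N * X := h1
        _ ≤ N * E := Nat.mul_le_mul_left _ (by omega)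
    exact Nat.le_of_mul_le_mul_right this hE
  have hK2 : 2 ≤ K := by
    rw [hK, pow_succ]
    have : 1 ≤ 2 ^ (3 * r) := Nat.one_le_two_pow
    omega
  have hcard : (U \ A).card + s = N := Finset.card_sdiff_add_card_eq_card hAU
  obtain ⟨B, hBU, hBs, hB⟩ := exists_subset_card_mul_sum_le (fun v => (G.nbrs A v).card)
    (U \ A) (k := s) (by nlinarith)
  have hAB : Disjoint A B := hdis.mono_right hBU
  have hT := hmax (A ∪ B) (Finset.union_subset hAU (hBU.trans Finset.sdiff_subset))
  rw [Finset.card_union_of_disjoint hAB, hBs] at hT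
  have hTX : s * X ≤ N * G.pairs (A ∪ B) (A ∪ B) := by
    have e1 : G.pairs A A + G.pairs B A ≤ G.pairs (A ∪ B) (A ∪ B) := by
      rw [pairs_union_left hAB, pairs_union_right hAB, pairs_union_right hAB]
      omega
    have e2 : s * G.pairs (U \ A) A ≤ N * G.pairs B A :=
      le_trans hB (Nat.mul_le_mul_right _ (by omega))
    have e3 : s * G.pairs A A ≤ N * G.pairs A A := Nat.mul_le_mul_right _ (by omega)
    have e4 := Nat.mul_le_mul_left N e1
    rw [hXA]
    linarith
  have hNpos : 0 < N := by omega
  have h2 : (X ^ r * N) * (s ^ r * N ^ r) ≤ (E ^ r * 2 ^ (r + 1) * s) * (s ^ r * N ^ r) := by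
    calc (X ^ r * N) * (s ^ r * N ^ r) = (s * X) ^ r * N ^ (r + 1) := by ring
      _ ≤ (N * G.pairs (A ∪ B) (A ∪ B)) ^ r * N ^ (r + 1) := by gcongr
      _ = N ^ r * (G.pairs (A ∪ B) (A ∪ B) ^ r * N ^ (r + 1)) := by ring
      _ ≤ N ^ r * (E ^ r * (s + s) ^ (r + 1)) := by gcongr
      _ = _ := by rw [← two_mul, mul_pow 2 s]; ring
  have h3 : X ^ r * N ≤ E ^ r * 2 ^ (r + 1) * s := Nat.le_of_mul_le_mul_right h2 (by positivity)
  -- `s ≤ N / K` and `K = 4 ^ r * 2 ^ (r + 1)`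
  have h4 : (4 * X) ^ r * (2 ^ (r + 1) * N) ≤ E ^ r * (2 ^ (r + 1) * N) := by
    calc (4 * X) ^ r * (2 ^ (r + 1) * N) = K * (X ^ r * N) := by
          rw [hK, mul_pow, show 3 * r + 1 = 2 * r + (r + 1) by ring, pow_add 2 (2 * r), pow_mul]
          ring
      _ ≤ K * (E ^ r * 2 ^ (r + 1) * s) := by gcongr
      _ = E ^ r * 2 ^ (r + 1) * (s * K) := by ring
      _ ≤ E ^ r * 2 ^ (r + 1) * N := by gcongr
      _ = _ := by ring
  exact (Nat.pow_le_pow_iff_left (by omega)).1 (Nat.le_of_mul_le_mul_right h4 (by positivity))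

/-- An induced version of Erdős–Simonovits regularisation: every graph with an edge has
an induced subgraph `S` whose degrees differ from `E / N` by bounded factors only, where `E` is the
degree sum and `N` the order of an intermediate induced subgraph `U` that is at least as dense, at
the scale `N ^ (1 + 1 / r)`, as the whole graph. -/
lemma exists_almost_regular {r : ℕ} (hr : 1 ≤ r) {V : Finset α} (hV : 0 < G.pairs V V) :
    ∃ U S : Finset α, S ⊆ U ∧ S.Nonempty ∧
      (G.pairs V V) ^ r * U.card ^ (r + 1) ≤ (G.pairs U U) ^ r * V.card ^ (r + 1) ∧
      (∀ v ∈ S, G.pairs U U ≤ 8 * U.card * (G.nbrs S v).card) ∧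
      ∀ v ∈ S, U.card * (G.nbrs S v).card ≤ 2 ^ (3 * r + 1) * G.pairs U U := by
  have hVne : V.Nonempty := by
    by_contra h
    rw [Finset.not_nonempty_iff_eq_empty] at h
    simp [h, pairs] at hV
  obtain ⟨U, hU, hUmax⟩ := Finset.exists_max_image (V.powerset.filter Finset.Nonempty)
    (fun T => ((G.pairs T T : ℚ) ^ r / (T.card : ℚ) ^ (r + 1)))
    ⟨V, by simp [hVne]⟩
  simp only [Finset.mem_filter, Finset.mem_powerset] at hU hUmax
  obtain ⟨hUV, hUne⟩ := hU
  have hUpos : 0 < U.card := hUne.card_pos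
  have hmax : ∀ T ⊆ V,
      (G.pairs T T) ^ r * U.card ^ (r + 1) ≤ (G.pairs U U) ^ r * T.card ^ (r + 1) := by
    intro T hT
    rcases T.eq_empty_or_nonempty with rfl | hTne
    · simp [pairs, show r ≠ 0 by omega]
    · have h := hUmax T ⟨hT, hTne⟩
      have : (0 : ℚ) < T.card := by exact_mod_cast hTne.card_pos
      have : (0 : ℚ) < U.card := by exact_mod_cast hUpos
      rw [div_le_div_iff₀ (by positivity) (by positivity)] at h
      exact_mod_cast h
  have hE : 0 < G.pairs U U := by
    by_contra h
    have h0 : G.pairs U U = 0 := by omega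
    have h1 := hmax V subset_rfl
    rw [h0, zero_pow (by omega), zero_mul] at h1
    have : 0 < G.pairs V V ^ r * U.card ^ (r + 1) := by positivity
    omega
  set A := U.filter fun v => 2 ^ (3 * r + 1) * G.pairs U U ≤ U.card * (G.nbrs U v).card with hA
  have hAU : A ⊆ U := Finset.filter_subset _ _
  have hX := four_mul_pairs_le hr hE (fun T hT => hmax T (hT.trans hUV)) hAU
    (fun v hv => (Finset.mem_filter.1 hv).2)
  -- the vertices of moderate degree still span half of the degree sum
  set W := U \ A with hW
  have hdis : Disjoint A W := Finset.disjoint_sdiff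
  have hAW : A ∪ W = U := Finset.union_sdiff_of_subset hAU
  have hWW : G.pairs U U ≤ 2 * G.pairs W W := by
    have e1 : G.pairs U U = G.pairs A U + G.pairs W U := by
      rw [← pairs_union_left hdis, hAW]
    have e2 : G.pairs W U = G.pairs W A + G.pairs W W := by
      rw [← pairs_union_right hdis, hAW]
    have e3 : G.pairs A U = G.pairs A A + G.pairs A W := by
      rw [← pairs_union_right hdis, hAW]
    have e4 := pairs_comm (G := G) A W
    omega
  -- in a maximiser of this linear functional, no vertex of degree below `E / (8 * N)` survives
  obtain ⟨S, hS, hSmax⟩ := Finset.exists_max_image W.powerset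
    (fun S => (4 * U.card * G.pairs S S : ℤ) - G.pairs U U * S.card) ⟨W, by simp⟩
  simp only [Finset.mem_powerset] at hS hSmax
  have hSU : S ⊆ U := hS.trans Finset.sdiff_subset
  refine ⟨U, S, hSU, ?_, hmax V subset_rfl, ?_, ?_⟩
  · by_contra hne
    rw [Finset.not_nonempty_iff_eq_empty] at hne
    have h1 := hSmax W subset_rfl
    have h2 : (W.card : ℤ) ≤ U.card := by exact_mod_cast Finset.card_le_card Finset.sdiff_subset
    have h3 : (G.pairs U U : ℤ) ≤ 2 * G.pairs W W := by exact_mod_cast hWW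
    have h4 : (0 : ℤ) < G.pairs U U := by exact_mod_cast hE
    have h5 : (0 : ℤ) < U.card := by exact_mod_cast hUpos
    simp only [hne, pairs, Finset.sum_empty, Finset.card_empty, Nat.cast_zero, mul_zero,
      sub_zero] at h1
    simp only [pairs] at h1 h3 h4
    nlinarith [mul_le_mul_of_nonneg_left h2 h4.le, mul_le_mul_of_nonneg_left h3 h5.le,
      mul_pos h4 h5]
  · intro v hv
    have h1 := hSmax (S.erase v) ((Finset.erase_subset _ _).trans hS)
    have h2 := pairs_eq_erase_add (G := G) hv
    have h3 := Finset.card_erase_add_one hv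
    rw [h2, ← h3] at h1
    push_cast at h1
    have : (G.pairs U U : ℤ) ≤ 8 * U.card * (G.nbrs S v).card := by nlinarith
    exact_mod_cast this
  · intro v hv
    have hvA : v ∉ A := (Finset.mem_sdiff.1 (hS hv)).2
    have h1 : ¬ 2 ^ (3 * r + 1) * G.pairs U U ≤ U.card * (G.nbrs U v).card := fun h =>
      hvA (Finset.mem_filter.2 ⟨hSU hv, h⟩)
    have h2 := Nat.mul_le_mul_left U.card (Finset.card_le_card (nbrs_mono (G := G) hSU v))
    omega

/-- A Moore-type bound for graphs without induced cycles of length `4, …, 2 * r`: the number of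
edges is at most of order `d ^ (1 - 1 / r) * n ^ (1 + 1 / r)`, if all cliques have at most `d`
vertices. -/
theorem NoHoles.pow_pairs_le {r d : ℕ} (hG : G.NoHoles (2 * r)) (hr : 2 ≤ r)
    (hd : G.CliqueFree (d + 1)) (V : Finset α) :
    (G.pairs V V) ^ r ≤
      8 ^ r * (512 * (8 * 2 ^ (3 * r + 1)) ^ 2) ^ r * (d ^ (r - 1) * V.card ^ (r + 1)) := by
  rcases Nat.eq_zero_or_pos (G.pairs V V) with h0 | hpos
  · rw [h0, zero_pow (by omega)]
    exact Nat.zero_le _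
  obtain ⟨U, S, hSU, hS, hUV, hlow, hhigh⟩ := exists_almost_regular (r := r) (by omega) hpos
  obtain ⟨v, hv, hmin⟩ := Finset.exists_min_image S (fun v => (G.nbrs S v).card) hS
  have hUpos : 0 < U.card := (hS.mono hSU).card_pos
  have hreg := hG.pow_le_of_almost_regular (K := 8 * 2 ^ (3 * r + 1)) hr hd
    (by have : 1 ≤ 2 ^ (3 * r + 1) := Nat.one_le_two_pow
        omega) hS hmin (by
      intro x hx
      refine Nat.le_of_mul_le_mul_left ?_ hUpos
      calc _ ≤ _ := hhigh x hx
        _ ≤ 2 ^ (3 * r + 1) * (8 * U.card * (G.nbrs S v).card) := by gcongr; exact hlow v hv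
        _ = _ := by ring)
  have hcard : S.card ≤ U.card := Finset.card_le_card hSU
  set C := (512 * (8 * 2 ^ (3 * r + 1)) ^ 2) ^ r
  refine Nat.le_of_mul_le_mul_right (c := U.card ^ (r + 1)) ?_ (by positivity)
  calc _ ≤ _ := hUV
    _ ≤ (8 * U.card * (G.nbrs S v).card) ^ r * V.card ^ (r + 1) := by gcongr; exact hlow v hv
    _ = 8 ^ r * U.card ^ r * (G.nbrs S v).card ^ r * V.card ^ (r + 1) := by ring
    _ ≤ 8 ^ r * U.card ^ r * (C * (U.card * d ^ (r - 1))) * V.card ^ (r + 1) := by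
        gcongr; exact hreg.trans (by gcongr)
    _ = _ := by ring

/-- Averaging the edge bound gives a vertex of small degree in every finite vertex set. -/
lemma NoHoles.exists_nbrs_pow_le {r d : ℕ} (hG : G.NoHoles (2 * r)) (hr : 2 ≤ r)
    (hd : G.CliqueFree (d + 1)) {V : Finset α} (hV : V.Nonempty) :
    ∃ v ∈ V, (G.nbrs V v).card ^ r ≤
      8 ^ r * (512 * (8 * 2 ^ (3 * r + 1)) ^ 2) ^ r * (d ^ (r - 1) * V.card) := by
  obtain ⟨v, hv, hmin⟩ := Finset.exists_min_image V (fun v => (G.nbrs V v).card) hV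
  refine ⟨v, hv, ?_⟩
  have h1 : V.card * (G.nbrs V v).card ≤ G.pairs V V := by
    rw [← smul_eq_mul]
    exact Finset.card_nsmul_le_sum _ _ _ hmin
  have hpos : 0 < V.card := hV.card_pos
  refine Nat.le_of_mul_le_mul_left (c := V.card ^ r) ?_ (by positivity)
  calc _ = (V.card * (G.nbrs V v).card) ^ r := by ring
    _ ≤ (G.pairs V V) ^ r := by gcongr
    _ ≤ _ := hG.pow_pairs_le hr hd V
    _ = _ := by ring

end SimpleGraph

/-! ### Counting cliques -/

namespace SimpleGraph

variable {α : Type*} {G : SimpleGraph α} [DecidableEq α] [DecidableRel G.Adj]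

variable (G) in
/-- The cliques of `G` with `j` vertices, all in the finite set `S`. -/
def cliquesIn (S : Finset α) (j : ℕ) : Finset (Finset α) :=
  (S.powersetCard j).filter fun T => ∀ p ∈ T, ∀ q ∈ T, p ≠ q → G.Adj p q

lemma mem_cliquesIn {S T : Finset α} {j : ℕ} : T ∈ G.cliquesIn S j ↔
    (T ⊆ S ∧ T.card = j) ∧ ∀ p ∈ T, ∀ q ∈ T, p ≠ q → G.Adj p q := by
  simp [cliquesIn, Finset.mem_powersetCard]

lemma card_cliquesIn_one (S : Finset α) : (G.cliquesIn S 1).card ≤ S.card :=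
  (Finset.card_filter_le _ _).trans (by simp)

lemma card_cliquesIn_succ_le (S : Finset α) (v : α) (j : ℕ) : (G.cliquesIn S (j + 1)).card ≤
    (G.cliquesIn (S.erase v) (j + 1)).card + (G.cliquesIn (G.nbrs S v) j).card := by
  rw [← Finset.card_filter_add_card_filter_not (s := G.cliquesIn S (j + 1)) (fun T => v ∉ T)]
  refine Nat.add_le_add (Finset.card_le_card fun T hT => ?_)
    (Finset.card_le_card_of_injOn (fun T => T.erase v) (fun T hT => ?_) fun T hT T' hT' h => ?_)
  · simp only [Finset.mem_filter, mem_cliquesIn] at hT ⊢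
    exact ⟨⟨Finset.subset_erase.2 ⟨hT.1.1.1, hT.2⟩, hT.1.1.2⟩, hT.1.2⟩
  · simp only [Finset.coe_filter, Set.mem_ofPred_eq, not_not, mem_cliquesIn] at hT
    obtain ⟨⟨⟨hTS, hTc⟩, hT⟩, hv⟩ := hT
    refine Finset.mem_coe.2 (mem_cliquesIn.2 ⟨⟨fun x hx => ?_, ?_⟩, fun p hp q hq => ?_⟩)
    · obtain ⟨hxv, hx⟩ := Finset.mem_erase.1 hx
      exact mem_nbrs.2 ⟨hTS hx, hT v hv x hx hxv.symm⟩
    · rw [Finset.card_erase_of_mem hv, hTc, Nat.add_sub_cancel]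
    · exact hT p (Finset.mem_of_mem_erase hp) q (Finset.mem_of_mem_erase hq)
  · simp only [Finset.coe_filter, Set.mem_ofPred_eq, not_not] at hT hT'
    rw [← Finset.insert_erase hT.2, ← Finset.insert_erase hT'.2]
    exact congrArg _ h

/-- Removing vertices one at a time, each with few cliques in its remaining neighbourhood. -/
lemma card_cliquesIn_succ_le_mul {V : Finset α} {j : ℕ} {B : ℝ}
    (h : ∀ U ⊆ V, U.Nonempty → ∃ v ∈ U, ((G.cliquesIn (G.nbrs U v) j).card : ℝ) ≤ B) :
    ((G.cliquesIn V (j + 1)).card : ℝ) ≤ V.card * B := by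
  induction V using Finset.strongInduction with
  | H V ih =>
  rcases V.eq_empty_or_nonempty with rfl | hV
  · simp [cliquesIn]
  obtain ⟨v, hv, hB⟩ := h V subset_rfl hV
  have h1 := ih (V.erase v) (Finset.erase_ssubset hv)
    fun U hU => h U (hU.trans (Finset.erase_subset _ _))
  have h2 : ((G.cliquesIn V (j + 1)).card : ℝ) ≤
      (G.cliquesIn (V.erase v) (j + 1)).card + (G.cliquesIn (G.nbrs V v) j).card := by
    exact_mod_cast card_cliquesIn_succ_le V v j
  have h3 : (V.card : ℝ) = (V.erase v).card + 1 := by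
    exact_mod_cast (Finset.card_erase_add_one hv).symm
  rw [h3]
  linarith

/-- The exponent sums `σ i = 1 / r + ⋯ + 1 / r ^ i` satisfy `σ (i + 1) = (1 + σ i) / r`. -/
lemma sum_inv_pow_succ {r : ℝ} (hr : r ≠ 0) (i : ℕ) :
    ∑ j ∈ Finset.Icc 1 (i + 1), 1 / r ^ j = (1 + ∑ j ∈ Finset.Icc 1 i, 1 / r ^ j) / r := by
  induction i with
  | zero => simp
  | succ i ih =>
    have h := Finset.sum_Icc_succ_top (show 1 ≤ i + 1 by omega) fun j => 1 / r ^ j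
    rw [Finset.sum_Icc_succ_top (by omega)]
    calc _ = (1 + ∑ j ∈ Finset.Icc 1 i, 1 / r ^ j) / r + 1 / r ^ (i + 1 + 1) := by rw [ih]
      _ = (1 + (∑ j ∈ Finset.Icc 1 i, 1 / r ^ j + 1 / r ^ (i + 1))) / r := by
        field_simp
        ring
      _ = _ := by rw [h]

/-- The clique-counting bound. Every induced subgraph has a vertex of degree at most
`D = (C * d ^ (r - 1) * n) ^ (1 / r)`, so the vertices can be ordered such that each has at most
`D` later neighbours; induction on `i` bounds the number of cliques with `i + 1` vertices among
these. -/
theorem exists_card_cliquesIn_le (r : ℕ) (hr : 2 ≤ r) (i : ℕ) :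
    ∃ C : ℝ, 0 ≤ C ∧ ∀ (α : Type*) [DecidableEq α] (G : SimpleGraph α) [DecidableRel G.Adj]
      (d : ℕ) (V : Finset α), 1 ≤ d → G.NoHoles (2 * r) → G.CliqueFree (d + 1) →
      ((G.cliquesIn V (i + 1)).card : ℝ) ≤
        C * (d : ℝ) ^ ((i : ℝ) - ∑ j ∈ Finset.Icc 1 i, 1 / (r : ℝ) ^ j)
          * (V.card : ℝ) ^ (1 + ∑ j ∈ Finset.Icc 1 i, 1 / (r : ℝ) ^ j) := by
  have hr0 : (r : ℝ) ≠ 0 := by positivity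
  induction i with
  | zero =>
    refine ⟨1, zero_le_one, fun α _ G _ d V _ _ _ => ?_⟩
    simpa using card_cliquesIn_one (G := G) V
  | succ i ih =>
    obtain ⟨C, hC, ih⟩ := ih
    set s : ℝ := ∑ j ∈ Finset.Icc 1 i, 1 / (r : ℝ) ^ j with hs
    have hs0 : 0 ≤ s := Finset.sum_nonneg fun j _ => by positivity
    set c : ℕ := 8 ^ r * (512 * (8 * 2 ^ (3 * r + 1)) ^ 2) ^ r with hc
    refine ⟨C * (c : ℝ) ^ ((1 + s) / r), by positivity, fun α _ G _ d V hd hG hGd => ?_⟩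
    rw [sum_inv_pow_succ hr0, ← hs]
    rcases V.eq_empty_or_nonempty with rfl | hV
    · rw [show G.cliquesIn ∅ (i + 1 + 1) = ∅ by simp [cliquesIn], Finset.card_empty, Nat.cast_zero]
      positivity
    have hd0 : (0 : ℝ) < d := by exact_mod_cast hd
    have hn0 : (0 : ℝ) < V.card := by exact_mod_cast hV.card_pos
    set D : ℝ := ((c : ℝ) * ((d : ℝ) ^ (r - 1) * V.card)) ^ ((r : ℝ)⁻¹) with hD
    have hbound : ((G.cliquesIn V (i + 1 + 1)).card : ℝ) ≤
        V.card * (C * (d : ℝ) ^ ((i : ℝ) - s) * D ^ (1 + s)) := by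
      refine card_cliquesIn_succ_le_mul fun U hU hUne => ?_
      obtain ⟨v, hv, hdeg⟩ := hG.exists_nbrs_pow_le hr hGd hUne
      refine ⟨v, hv, (ih α G d (G.nbrs U v) hd hG hGd).trans ?_⟩
      have hle : ((G.nbrs U v).card : ℝ) ≤ D := by
        rw [hD, ← Real.pow_rpow_inv_natCast (Nat.cast_nonneg (G.nbrs U v).card)
          (show r ≠ 0 by omega)]
        refine Real.rpow_le_rpow (by positivity) ?_ (by positivity)
        have : (G.nbrs U v).card ^ r ≤ c * (d ^ (r - 1) * V.card) :=
          hdeg.trans (by gcongr)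
        exact_mod_cast this
      gcongr
    refine hbound.trans (le_of_eq ?_)
    have e1 : D ^ (1 + s) = (c : ℝ) ^ ((1 + s) / r) *
        ((d : ℝ) ^ (((r : ℝ) - 1) * ((1 + s) / r)) * (V.card : ℝ) ^ ((1 + s) / r)) := by
      rw [hD, ← Real.rpow_mul (by positivity), show (r : ℝ)⁻¹ * (1 + s) = (1 + s) / r by ring,
        Real.mul_rpow (by positivity) (by positivity), Real.mul_rpow (by positivity) (by positivity),
        ← Real.rpow_natCast, ← Real.rpow_mul hd0.le, Nat.cast_sub (by omega), Nat.cast_one]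
    have e2 : (d : ℝ) ^ (((i + 1 : ℕ) : ℝ) - (1 + s) / r) =
        (d : ℝ) ^ ((i : ℝ) - s) * (d : ℝ) ^ (((r : ℝ) - 1) * ((1 + s) / r)) := by
      rw [← Real.rpow_add hd0]
      congr 1
      push_cast
      field_simp
      ring
    rw [e1, e2, Real.rpow_add hn0, Real.rpow_one]
    ring

end SimpleGraph

/-! ### From the girth to the graph -/

namespace FinSimplicialComplex

variable {α : Type*} [LinearOrder α]

/-- The edge from `u` to `v` as an oriented `1`-chain, with boundary `v - u`. -/
noncomputable def orientedEdge (k : Type*) [Field k] (u v : α) : Finset α →₀ k :=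
  if u < v then Finsupp.single {u, v} 1 else -Finsupp.single {u, v} 1

lemma boundary_single_pair (k : Type*) [Field k] {u v : α} (h : u < v) :
    boundary k α (Finsupp.single {u, v} 1) = Finsupp.single {v} 1 - Finsupp.single {u} 1 := by
  have h1 : ({u, v} : Finset α).erase u = {v} := by
    rw [Finset.erase_insert (by simpa using h.ne)]
  have h2 : ({u, v} : Finset α).erase v = {u} := by
    rw [Finset.pair_comm, Finset.erase_insert (by simpa using h.ne')]
  have h3 : ({u, v} : Finset α).filter (fun w => w < u) = ∅ := by
    rw [Finset.filter_eq_empty_iff]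
    simp [h.le]
  have h4 : ({u, v} : Finset α).filter (fun w => w < v) = {u} := by
    ext w
    simp only [Finset.mem_filter, Finset.mem_insert, Finset.mem_singleton]
    constructor
    · rintro ⟨rfl | rfl, hw⟩
      · rfl
      · exact (lt_irrefl _ hw).elim
    · rintro rfl
      exact ⟨Or.inl rfl, h⟩
  rw [boundary, Finsupp.linearCombination_single, one_smul, Finset.sum_pair h.ne, h1, h2, h3, h4]
  simp [sub_eq_add_neg]

lemma boundary_orientedEdge (k : Type*) [Field k] {u v : α} (h : u ≠ v) :
    boundary k α (orientedEdge k u v) = Finsupp.single {v} 1 - Finsupp.single {u} 1 := by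
  rcases h.lt_or_gt with h | h
  · rw [orientedEdge, if_pos h, boundary_single_pair k h]
  · rw [orientedEdge, if_neg h.not_gt, map_neg, Finset.pair_comm, boundary_single_pair k h,
      neg_sub]

/-- A closed edge path on `m ≥ 3` distinct vertices of a complex without triangles is a cycle that
is not a boundary. -/
lemma nontrivial_reducedHomology_one (k : Type*) [Field k] {Δ : FinSimplicialComplex α} {m : ℕ}
    (hm : 3 ≤ m) {x : ℕ → α} (hx : ∀ a b, a < b → b < m → x a ≠ x b) (hxm : x m = x 0)
    (hedge : ∀ i < m, {x i, x (i + 1)} ∈ Δ.faces) (htri : ∀ F ∈ Δ.faces, F.card ≠ 3) :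
    Nontrivial (Δ.ReducedHomology k 1) := by
  have hne : ∀ i < m, x i ≠ x (i + 1) := by
    intro i hi
    rcases Nat.lt_or_ge (i + 1) m with h | h
    · exact hx i (i + 1) (by omega) h
    · rw [show i + 1 = m by omega, hxm]
      exact (hx 0 i (by omega) hi).symm
  set z : Finset α →₀ k := ∑ i ∈ Finset.range m, orientedEdge k (x i) (x (i + 1)) with hz
  have hzc : z ∈ Δ.cycles k 1 := by
    refine Submodule.mem_inf.2 ⟨Submodule.sum_mem _ fun i hi => ?_, ?_⟩
    · have hi := Finset.mem_range.1 hi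
      have h1 : Finsupp.single {x i, x (i + 1)} (1 : k) ∈ Δ.chains k 1 :=
        Finsupp.single_mem_supported k _ ⟨hedge i hi, by rw [Finset.card_pair (hne i hi)]; norm_num⟩
      unfold orientedEdge
      split_ifs
      · exact h1
      · exact Submodule.neg_mem _ h1
    · rw [LinearMap.mem_ker, hz, map_sum, Finset.sum_congr rfl fun i hi =>
        boundary_orientedEdge k (hne i (Finset.mem_range.1 hi)),
        Finset.sum_range_sub (fun i => Finsupp.single {x i} (1 : k)), hxm, sub_self]
  have hz0 : z ≠ 0 := by
    intro h
    -- the edge from `x 0` to `x 1` occurs only once in the cycle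
    have hoth : ∀ i ∈ Finset.range m, i ≠ 0 →
        orientedEdge k (x i) (x (i + 1)) {x 0, x 1} = 0 := by
      intro i hi hi0
      have hi := Finset.mem_range.1 hi
      have hpair : ({x i, x (i + 1)} : Finset α) ≠ {x 0, x 1} := by
        intro h
        have h1 : x i ∈ ({x 0, x 1} : Finset α) := h ▸ Finset.mem_insert_self _ _
        have h2 : x (i + 1) ∈ ({x 0, x 1} : Finset α) := h ▸ by simp
        simp only [Finset.mem_insert, Finset.mem_singleton] at h1 h2
        rcases h1 with h1 | h1
        · exact hx 0 i (by omega) hi h1.symm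
        · have hi1 : i = 1 := by
            by_contra hne
            exact hx 1 i (by omega) hi h1.symm
          subst hi1
          rcases h2 with h2 | h2
          · exact hx 0 2 (by omega) (by omega) h2.symm
          · exact hx 1 2 (by omega) (by omega) h2.symm
      unfold orientedEdge
      split_ifs <;> simp [Finsupp.single_eq_of_ne' hpair]
    have h0 := DFunLike.congr_fun h {x 0, x 1}
    rw [hz, Finsupp.finsetSum_apply, Finset.sum_eq_single 0 hoth (by simp; omega)] at h0
    unfold orientedEdge at h0
    split_ifs at h0 <;> simp at h0
  have hB : Δ.boundaries k 1 = ⊥ := by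
    have : Δ.chains k (1 + 1) = ⊥ := by
      unfold chains
      have : {F : Finset α | F ∈ Δ.faces ∧ (F.card : ℤ) = 1 + 1 + 1} = ∅ := by
        ext F
        simp only [Set.mem_ofPred_eq, Set.mem_empty_iff_false, iff_false, not_and]
        intro hF h
        exact htri F hF (by omega)
      rw [this, Finsupp.supported_empty]
    rw [boundaries, this, Submodule.map_bot]
  refine Submodule.Quotient.nontrivial_iff.2 fun h => hz0 ?_
  have : (⟨z, hzc⟩ : Δ.cycles k 1) ∈ (Δ.boundaries k 1).submoduleOf (Δ.cycles k 1) := by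
    rw [h]; trivial
  rw [hB] at this
  simpa [Submodule.submoduleOf] using this

/-- The `1`-skeleton of a simplicial complex. -/
def oneSkeleton (Γ : FinSimplicialComplex α) : SimpleGraph α where
  Adj u v := u ≠ v ∧ {u, v} ∈ Γ.faces
  symm := ⟨fun u v h => ⟨h.1.symm, by rw [Finset.pair_comm]; exact h.2⟩⟩
  loopless := ⟨fun u h => h.1 rfl⟩

instance (Γ : FinSimplicialComplex α) : DecidableRel Γ.oneSkeleton.Adj := fun u v =>
  inferInstanceAs (Decidable (u ≠ v ∧ {u, v} ∈ Γ.faces))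

variable {k : Type*} [Field k] {Γ : FinSimplicialComplex α}

/-- A closed edge path on `m ≥ 3` distinct vertices in the link of a face that spans no triangle of
the link bounds the `1`-girth by `m`. -/
lemma girth_one_le {F : Finset α} (hF : F ∈ Γ.faces) {m : ℕ} (hm : 3 ≤ m) {x : ℕ → α}
    (hx : ∀ a b, a < b → b < m → x a ≠ x b) (hxm : x m = x 0)
    (hedge : ∀ i < m, {x i, x (i + 1)} ∈ (Γ.link F).faces)
    (htri : ∀ H ∈ (Γ.link F).faces, H ⊆ (Finset.range m).image x → H.card ≠ 3) :
    Γ.girth k 1 ≤ m := by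
  have hmem : ∀ i < m, x i ∈ (Finset.range m).image x := fun i hi =>
    Finset.mem_image_of_mem _ (Finset.mem_range.2 hi)
  have hmem' : ∀ i ≤ m, x i ∈ (Finset.range m).image x := by
    intro i hi
    rcases hi.eq_or_lt with rfl | hi
    · rw [hxm]
      exact hmem 0 (by omega)
    · exact hmem i hi
  refine sInf_le ⟨F, hF, (Finset.range m).image x, ?_, ?_, ?_⟩
  · intro v hv
    obtain ⟨i, hi, rfl⟩ := Finset.mem_image.1 hv
    exact (Γ.link F).subset_verts _ (hedge i (Finset.mem_range.1 hi)) (Finset.mem_insert_self _ _)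
  · refine nontrivial_reducedHomology_one k hm hx hxm (fun i hi => ?_) fun H hH => ?_
    · refine Finset.mem_filter.2 ⟨hedge i hi, ?_⟩
      rw [Finset.insert_subset_iff, Finset.singleton_subset_iff]
      exact ⟨hmem i hi, hmem' (i + 1) hi⟩
    · exact htri H (Finset.mem_filter.1 hH).1 (Finset.mem_filter.1 hH).2
  · rw [Finset.card_image_of_injOn, Finset.card_range]
    intro a ha b hb hab
    simp only [Finset.coe_range, Set.mem_Iio] at ha hb
    by_contra hne
    rcases Nat.lt_or_gt_of_ne hne with h | h
    · exact hx a b h hb hab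
    · exact hx b a h ha hab.symm

lemma mem_link_faces {F H : Finset α} :
    H ∈ (Γ.link F).faces ↔ Disjoint H F ∧ H ∪ F ∈ Γ.faces := by
  simp only [link, Finset.mem_image, Finset.mem_filter]
  constructor
  · rintro ⟨G, ⟨hG, hFG⟩, rfl⟩
    exact ⟨Finset.sdiff_disjoint, by rwa [Finset.sdiff_union_of_subset hFG]⟩
  · rintro ⟨hd, h⟩
    exact ⟨H ∪ F, ⟨h, Finset.subset_union_right⟩, by
      rw [Finset.union_sdiff_right, Finset.sdiff_eq_self_of_disjoint hd]⟩

lemma noHoles_oneSkeleton {N : ℕ} (h : (N : ℕ∞) < Γ.girth k 1) : Γ.oneSkeleton.NoHoles N := by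
  intro m x hm hmN hx
  set y : ℕ → α := fun i => if i = m then x 0 else x i with hy
  have y0 : y m = x 0 := by simp [hy]
  have y1 : ∀ i < m, y i = x i := fun i hi => by simp [hy, hi.ne]
  have hadj : ∀ i < m, Γ.oneSkeleton.Adj (y i) (y (i + 1)) := by
    intro i hi
    rcases Nat.lt_or_ge (i + 1) m with h' | h'
    · rw [y1 i hi, y1 _ h']
      exact (hx i (i + 1) (by omega) h').2.2 (Or.inl rfl)
    · rw [show i + 1 = m by omega, y0, y1 i hi]
      exact ((hx 0 i (by omega) hi).2.2 (Or.inr ⟨rfl, by omega⟩)).symm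
  have hempty : (∅ : Finset α) ∈ Γ.faces :=
    Γ.down_closed _ (hadj 0 (by omega)).2 _ (Finset.empty_subset _)
  have hle : Γ.girth k 1 ≤ m := by
    refine girth_one_le hempty (by omega) (x := y) (fun a b hab hb => ?_) ?_ (fun i hi => ?_) ?_
    · rw [y1 a (by omega), y1 b hb]
      exact (hx a b hab hb).1
    · rw [y0, y1 0 (by omega)]
    · rw [mem_link_faces]
      exact ⟨Finset.disjoint_empty_right _, by simpa using (hadj i hi).2⟩
    · -- an induced cycle of length at least `4` contains no triangle
      intro H hH hHx hcard
      have hHΓ : H ∈ Γ.faces := by simpa using (mem_link_faces.1 hH).2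
      have hadjH : ∀ a < m, ∀ b < m, y a ∈ H → y b ∈ H → a < b →
          b = a + 1 ∨ (a = 0 ∧ b + 1 = m) := by
        intro a ha b hb hya hyb hab
        rw [y1 a ha] at hya
        rw [y1 b hb] at hyb
        refine (hx a b hab hb).2.1 ⟨(hx a b hab hb).1, Γ.down_closed _ hHΓ _ ?_⟩
        rw [Finset.insert_subset_iff, Finset.singleton_subset_iff]
        exact ⟨hya, hyb⟩
      obtain ⟨p, q, s, hpq, hps, hqs, rfl⟩ := Finset.card_eq_three.1 hcard
      obtain ⟨a, ha, rfl⟩ := Finset.mem_image.1 (hHx (show p ∈ _ by simp))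
      obtain ⟨b, hb, rfl⟩ := Finset.mem_image.1 (hHx (show q ∈ _ by simp))
      obtain ⟨c, hc, rfl⟩ := Finset.mem_image.1 (hHx (show s ∈ _ by simp))
      rw [Finset.mem_range] at ha hb hc
      have hab : a ≠ b := fun h => hpq (by rw [h])
      have hac : a ≠ c := fun h => hps (by rw [h])
      have hbc : b ≠ c := fun h => hqs (by rw [h])
      have k1 := hadjH a ha b hb (by simp) (by simp)
      have k2 := hadjH b hb a ha (by simp) (by simp)
      have k3 := hadjH a ha c hc (by simp) (by simp)
      have k4 := hadjH c hc a ha (by simp) (by simp)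
      have k5 := hadjH b hb c hc (by simp) (by simp)
      have k6 := hadjH c hc b hb (by simp) (by simp)
      omega
  have := h.trans_le hle
  rw [Nat.cast_lt] at this
  omega

/-- A complex of `1`-girth greater than `3` is flag: if `T` were a minimal missing face, then the
link of `T` minus three of its vertices would contain an empty triangle on these vertices. -/
lemma mem_faces_of_clique (h : ((3 : ℕ) : ℕ∞) < Γ.girth k 1) (T : Finset α) (hT : 2 ≤ T.card)
    (hcl : ∀ p ∈ T, ∀ q ∈ T, p ≠ q → Γ.oneSkeleton.Adj p q) : T ∈ Γ.faces := by
  induction T using Finset.strongInduction with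
  | H T ih =>
  rcases hT.eq_or_lt with h2 | h3
  · obtain ⟨p, q, hpq, rfl⟩ := Finset.card_eq_two.1 h2.symm
    exact (hcl p (by simp) q (by simp) hpq).2
  by_contra hTΓ
  have hsub : ∀ v ∈ T, T.erase v ∈ Γ.faces := fun v hv =>
    ih _ (Finset.erase_ssubset hv) (by rw [Finset.card_erase_of_mem hv]; omega)
      fun p hp q hq => hcl p (Finset.mem_of_mem_erase hp) q (Finset.mem_of_mem_erase hq)
  have hproper : ∀ H ⊆ T, H ≠ T → H ∈ Γ.faces := by
    intro H hH hne
    obtain ⟨v, hv, hvH⟩ := Finset.exists_of_ssubset (hH.ssubset_of_ne hne)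
    exact Γ.down_closed _ (hsub v hv) _ (Finset.subset_erase.2 ⟨hH, hvH⟩)
  obtain ⟨W, hWT, hW⟩ := Finset.exists_subset_card_eq h3
  obtain ⟨p, q, s, hpq, hps, hqs, rfl⟩ := Finset.card_eq_three.1 hW
  set F := T \ {p, q, s} with hF
  have hFW : {p, q, s} ∪ F = T := Finset.union_sdiff_of_subset hWT
  have hdis : Disjoint {p, q, s} F := Finset.disjoint_sdiff
  have hFΓ : F ∈ Γ.faces := hproper F Finset.sdiff_subset fun hFT => by
    have : p ∈ F := hFT ▸ hWT (by simp)
    simp [hF] at this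
  have hlink : ∀ H ⊆ ({p, q, s} : Finset α), H.card < 3 → H ∈ (Γ.link F).faces := by
    intro H hH hc
    refine mem_link_faces.2 ⟨hdis.mono_left hH, hproper _ ?_ fun hHT => ?_⟩
    · exact Finset.union_subset (hH.trans hWT) Finset.sdiff_subset
    · have e1 := Finset.card_union_le H F
      have e2 := Finset.card_union_of_disjoint hdis
      rw [hFW] at e2
      rw [hHT] at e1
      omega
  set x : ℕ → α := fun i => if i = 1 then q else if i = 2 then s else p with hx
  have hle : Γ.girth k 1 ≤ (3 : ℕ) := by
    refine girth_one_le hFΓ le_rfl (x := x) (fun a b hab hb => ?_) (by simp [hx])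
      (fun i hi => hlink _ ?_ ?_) fun H hH hHx hc => hTΓ ?_
    · interval_cases b <;> interval_cases a <;> simp [*]
    · intro v hv
      simp only [Finset.mem_insert, Finset.mem_singleton] at hv ⊢
      interval_cases i <;> simp [hx] at hv <;> tauto
    · exact Finset.card_le_two.trans_lt (by norm_num)
    · have hHW : H ⊆ {p, q, s} := hHx.trans fun v hv => by
        obtain ⟨i, hi, rfl⟩ := Finset.mem_image.1 hv
        have := Finset.mem_range.1 hi
        interval_cases i <;> simp [hx]
      rw [← hFW, ← Finset.eq_of_subset_of_card_le hHW (by omega)]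
      exact (mem_link_faces.1 hH).2
  exact absurd h (not_lt.2 hle)

end FinSimplicialComplex

theorem mainTheorem2 (r i : ℕ) (hr : 2 ≤ r) :
    ∃ C : ℝ, ∀ (k : Type*) [Field k] (α : Type*) [LinearOrder α]
      (Γ : FinSimplicialComplex α) (n d : ℕ),
      Γ.verts.card = n → Γ.dim = (d : ℤ) - 1 → ((2 * r : ℕ) : ℕ∞) < Γ.girth k 1 →
      (Γ.faceNumber i : ℝ) ≤
        C * (d : ℝ) ^ ((i : ℝ) - ∑ j ∈ Finset.Icc 1 i, 1 / (r : ℝ) ^ j)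
          * (n : ℝ) ^ (1 + ∑ j ∈ Finset.Icc 1 i, 1 / (r : ℝ) ^ j) := by
  obtain ⟨C, hC, hbound⟩ := SimpleGraph.exists_card_cliquesIn_le r hr i
  refine ⟨C, fun k _ α _ Γ n d hn hdim hgirth => ?_⟩
  have hface : ∀ F ∈ Γ.faces, F.card ≤ d := by
    intro F hF
    have h1 : F.card ≤ Γ.faces.sup Finset.card := Finset.le_sup hF
    have h2 : Γ.faces.sup Finset.card = d := by
      rw [FinSimplicialComplex.dim] at hdim
      omega
    omega
  rcases Nat.eq_zero_or_pos d with rfl | hd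
  · -- only the empty set can be a face
    have : Γ.faceNumber i = 0 := by
      refine Finset.card_eq_zero.2 (Finset.filter_eq_empty_iff.2 fun F hF => ?_)
      have := hface F hF
      omega
    rw [this, Nat.cast_zero]
    positivity
  have hflag : ∀ T : Finset α, 2 ≤ T.card →
      (∀ p ∈ T, ∀ q ∈ T, p ≠ q → Γ.oneSkeleton.Adj p q) → T ∈ Γ.faces :=
    FinSimplicialComplex.mem_faces_of_clique
      (lt_of_le_of_lt (Nat.cast_le.2 (show 3 ≤ 2 * r by omega)) hgirth)
  have hclique : Γ.oneSkeleton.CliqueFree (d + 1) := by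
    intro T hT
    have := hface T (hflag T (by rw [hT.card_eq]; omega)
      fun p hp q hq hpq => hT.isClique hp hq hpq)
    rw [hT.card_eq] at this
    omega
  have hcount : Γ.faceNumber i ≤ (Γ.oneSkeleton.cliquesIn Γ.verts (i + 1)).card := by
    refine Finset.card_le_card fun F hF => ?_
    obtain ⟨hF, hFc⟩ := Finset.mem_filter.1 hF
    refine SimpleGraph.mem_cliquesIn.2 ⟨⟨Γ.subset_verts F hF, hFc⟩, fun p hp q hq hpq =>
      ⟨hpq, Γ.down_closed F hF _ ?_⟩⟩
    rw [Finset.insert_subset_iff, Finset.singleton_subset_iff]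
    exact ⟨hp, hq⟩
  rw [← hn]
  exact (Nat.cast_le.2 hcount).trans
    (hbound α Γ.oneSkeleton d Γ.verts hd (FinSimplicialComplex.noHoles_oneSkeleton hgirth) hclique)
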